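/- All hypergraphs are finite and have no repeated edges: a hypergraph consists of a finite vertex set and a set of subsets of it, called edges. It is $r$-uniform if every edge has exactly $r$ vertices; its maximum degree is the largest number of edges containing a common vertex. A vertex coloring is conflict-free if every edge contains a vertex whose color is assigned to no other vertex of that edge; the conflict-free chromatic number is the minimum number of colors in a conflict-free coloring. For positive integers $r,\Delta$ let $f(r,\Delta)$ be the largest conflict-free chromatic number of an $r$-uniform hypergraph with maximum degree exactly $\Delta$ (for $r=1$ and $\Delta\ge 2$ there is no such hypergraph, and we put $f(1,\Delta)=0$). **Theorem.** Let $r,\Delta$ denote positive integers. 1. If $r=2$, or if $\Delta=2$ and $r\notin\{1,3,5\}$, then $f(r,\Delta)=\Delta+1$. 2. For every $r$ there is a constant $c_r$, depending only on $r$, such that $f(r,\Delta)\le c_r\,\Delta^{2/r}$ for all $\Delta$. 3. There are absolute constants $c,c_0$ such that $f(r,\Delta)\le\Delta$ whenever $r\ge c$ and $\Delta\ge c_0\ln r$. 4. If $\Delta\ge 3$, then $f(4,\Delta)\le\Delta$. -/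

import Mathlib

namespace Hypergraph

/-- Every edge has exactly `r` vertices. -/
def IsUniform {α : Type*} (H : Hypergraph α) (r : ℕ) : Prop :=
  ∀ e ∈ H.edgeSet, e.encard = r

/-- The degree of a vertex: the number of edges containing it. -/
noncomputable def degree {α : Type*} (H : Hypergraph α) (x : α) : ℕ∞ :=
  {e : Set α | e ∈ H.edgeSet ∧ x ∈ e}.encard

/-- The maximum degree (`0` if there is no vertex). -/
noncomputable def maxDegree {α : Type*} (H : Hypergraph α) : ℕ∞ :=
  ⨆ x ∈ H.vertexSet, H.degree x

/-- A coloring is conflict-free if each edge contains a vertex whose color is assigned to no other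
vertex of that edge. -/
def IsConflictFree {α κ : Type*} (H : Hypergraph α) (c : α → κ) : Prop :=
  ∀ e ∈ H.edgeSet, ∃ x ∈ e, ∀ y ∈ e, y ≠ x → c y ≠ c x

/-- There is a conflict-free coloring whose colors on the vertices lie in `{0, …, k - 1}`
(the values of `c` outside the vertex set are irrelevant). -/
def ConflictFreeColorable {α : Type*} (H : Hypergraph α) (k : ℕ) : Prop :=
  ∃ c : α → ℕ, (∀ x ∈ H.vertexSet, c x < k) ∧ H.IsConflictFree c

/-- The conflict-free chromatic number: the least number of colors of a conflict-free coloring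
(`⊤` if there is none with finitely many colors). -/
noncomputable def cfChromaticNumber {α : Type*} (H : Hypergraph α) : ℕ∞ :=
  ⨅ k ∈ {k : ℕ | H.ConflictFreeColorable k}, (k : ℕ∞)

/-- The conflict-free chromatic numbers of the finite `r`-uniform hypergraphs of maximum
degree `Δ`. -/
def cfChromaticNumbers (r Δ : ℕ) : Set ℕ∞ :=
  {k | ∃ (α : Type) (H : Hypergraph α),
    H.vertexSet.Finite ∧ H.IsUniform r ∧ H.maxDegree = Δ ∧ H.cfChromaticNumber = k}

/-- The largest conflict-free chromatic number of a finite `r`-uniform hypergraph of maximum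
degree `Δ`. As a supremum in `ℕ∞` it is `⊤` if these numbers are unbounded, and otherwise it is
their maximum, as soon as there is such a hypergraph. -/
noncomputable def maxCfChromaticNumber (r Δ : ℕ) : ℕ∞ :=
  sSup (cfChromaticNumbers r Δ)

end Hypergraph

/-!
Upper bounds only concern finite set systems, with edges as finsets of a finite vertex type.

* The bound `Δ + 1` holds for all set systems with nonempty edges (`exists_coloring_succ`): give one
  color to the complement of a minimal hitting set `X`, and recurse on the traces on `X` of the
  edges that meet `X` more than once. It is attained for `r = 2` by the complete graph, and
  for `Δ = 2` by duals of small multigraphs, in which a conflict-free `2`-coloring of the hypergraph would be a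
  spanning subgraph with all degrees in `{1, r - 1}`; these are excluded by parity
  (`three_le_maxCfChromaticNumber_of_dual`).

* The bounds `c_r * Δ ^ (2 / r)` and `Δ` for large `r` come from random colorings and the Lovász
  local lemma, in a counting form (`exists_forall_not_bad`, `exists_forall_unique`). With `k`
  uniformly random colors, an edge without a unique color has at most `r / 2` colors, and this has
  probability `O_r(k ^ (-⌈r / 2⌉))` (`noUniqueCount_univ_le`). This settles all `Δ` for fixed `r`,
  and `Δ ≥ 8 * r` for large `r`. If `Δ ≤ 8 * r`, about `Δ / 8` colors of probability `1 / r` each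
  are used, and a last color for the rest. Each of these colors fails to be unique on an edge with
  probability about `1 - 1 / e`, and Poissonization makes them independent at the cost of a factor
  of order `r` (`noUniqueCount_Ici_le`), so an edge is bad with probability exponentially small in
  `Δ`, which is enough as `Δ` is at least a large multiple of `log r`.

* The case `r = 4` is an analogue of Brooks' theorem (`exists_coloring_of_card_eq_four`). If three
  vertices of an edge are colored, at most one color is forbidden at the fourth one, and none if the
  three colors differ. In a minimal counterexample any edge can be made the only bad one, and the
  bad edge can be moved along any walk by recoloring one vertex per step
  (`OnlyBad.exists_update`). In a suitable edge `g`, close to an end of the hypergraph, the bad edge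
  can leave `g` at one vertex, which is given a third color, and come back at a vertex whose color
  was different (`not_onlyBad_of_connected`). This is impossible, because no color is forbidden at
  the latter vertex by then.
-/

namespace ConflictFree

open Finset

/-! ### Finite set systems -/

/-- Some color occurs exactly once on `e` under the coloring `φ`. -/
def HasUniqueColor {α κ : Type*} (φ : α → κ) (e : Finset α) : Prop :=
  ∃ x ∈ e, ∀ y ∈ e, y ≠ x → φ y ≠ φ x

/-- Only the vertex set, as a finite type, and the edges, as finsets, matter for upper bounds. -/
lemma maxCfChromaticNumber_le {r Δ k : ℕ}
    (h : ∀ (α : Type) [Fintype α] [DecidableEq α] (E : Finset (Finset α)),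
      (∀ e ∈ E, #e = r) → (∀ x, #{e ∈ E | x ∈ e} ≤ Δ) →
      ∃ φ : α → Fin k, ∀ e ∈ E, HasUniqueColor φ e) :
    Hypergraph.maxCfChromaticNumber r Δ ≤ k := by
  classical
  refine sSup_le ?_
  rintro _ ⟨α, H, hfin, hunif, hdeg, rfl⟩
  refine iInf₂_le k ?_
  have : Fintype H.vertexSet := hfin.fintype
  set E : Finset (Finset H.vertexSet) :=
    {e | ((↑) '' (e : Set H.vertexSet) : Set α) ∈ H.edgeSet} with hE
  have inj : Function.Injective
      (fun e : Finset H.vertexSet ↦ ((↑) '' (e : Set H.vertexSet) : Set α)) :=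
    (Set.image_injective.2 Subtype.val_injective).comp Finset.coe_injective
  refine (h H.vertexSet E ?_ ?_).elim fun φ hφ ↦ ?_
  · intro e he
    have := hunif _ (by simpa [hE] using he)
    rw [Subtype.val_injective.encard_image, Set.encard_coe_eq_coe_finsetCard] at this
    exact_mod_cast this
  · intro x
    have hx : H.degree x ≤ Δ := hdeg ▸
      le_iSup₂ (f := fun x (_ : x ∈ H.vertexSet) ↦ H.degree x) _ x.2
    have : ((#{e ∈ E | x ∈ e} : ℕ) : ℕ∞) ≤ H.degree x := by
      rw [← Set.encard_coe_eq_coe_finsetCard, ← inj.encard_image]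
      refine Set.encard_le_encard ?_
      rintro _ ⟨e, he, rfl⟩
      simp only [hE, coe_filter, mem_filter, mem_univ, true_and, Set.mem_ofPred_eq] at he
      exact ⟨he.1, ⟨x, he.2, rfl⟩⟩
    exact_mod_cast this.trans hx
  · refine ⟨fun x ↦ if hx : x ∈ H.vertexSet then φ ⟨x, hx⟩ else 0, ?_, ?_⟩
    · intro x hx
      simp [hx]
    · intro e he
      have hsub := H.subset_vertexSet_of_mem_edgeSet he
      have hmem : ({x | (x : α) ∈ e} : Finset H.vertexSet) ∈ E := by
        have : ((↑) '' {x : H.vertexSet | (x : α) ∈ e} : Set α) = e := by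
          ext x
          simpa using fun hx ↦ hsub hx
        simpa [hE, this] using he
      obtain ⟨x, hx, hxu⟩ := hφ _ hmem
      refine ⟨x, by simpa using hx, fun y hy hyx ↦ ?_⟩
      have := hxu ⟨y, hsub hy⟩ (by simpa using hy) (fun h ↦ hyx (by rw [← h]))
      simp only [hsub hy, x.2, dite_true]
      exact fun h ↦ this (Fin.ext h)

/-- A single hypergraph without a conflict-free coloring by `k` colors bounds the maximum from
below. -/
lemma succ_le_maxCfChromaticNumber {α : Type} {r Δ k : ℕ} (H : Hypergraph α)
    (hfin : H.vertexSet.Finite) (hunif : H.IsUniform r) (hdeg : H.maxDegree = Δ)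
    (hk : ¬ H.ConflictFreeColorable k) :
    (k : ℕ∞) + 1 ≤ Hypergraph.maxCfChromaticNumber r Δ := by
  refine le_trans ?_ (le_sSup ⟨α, H, hfin, hunif, hdeg, rfl⟩)
  refine le_iInf₂ fun l hl ↦ ?_
  have : k < l := by
    by_contra! hlk
    obtain ⟨c, hc, hcf⟩ := hl
    exact hk ⟨c, fun x hx ↦ (hc x hx).trans_le hlk, hcf⟩
  exact_mod_cast this

/-! ### One color more than the maximum degree -/

/-- The degree bound `Δ + 1` of Pach and Tardos: give color `0` to the complement of a minimal
hitting set `X`. Edges meeting `X` once are then settled, and since every vertex of `X` lies in such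
an edge, the traces on `X` of the other edges form a set system of smaller maximum degree. -/
lemma exists_coloring_succ {α : Type*} [Fintype α] [DecidableEq α] (Δ : ℕ) :
    ∀ E : Finset (Finset α), (∀ e ∈ E, e.Nonempty) → (∀ x, #{e ∈ E | x ∈ e} ≤ Δ) →
      ∃ φ : α → Fin (Δ + 1), ∀ e ∈ E, HasUniqueColor φ e := by
  induction Δ with
  | zero =>
    intro E hne hdeg
    refine ⟨fun _ ↦ 0, fun e he ↦ ?_⟩
    obtain ⟨x, hx⟩ := hne e he
    have := hdeg x
    simp only [nonpos_iff_eq_zero, card_eq_zero, filter_eq_empty_iff] at this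
    exact absurd hx (this he)
  | succ Δ ih =>
    intro E hne hdeg
    obtain ⟨X, hX⟩ : ∃ X, Minimal (fun X : Finset α ↦ ∀ e ∈ E, (e ∩ X).Nonempty) X :=
      exists_minimal_of_wellFoundedLT _ ⟨univ, by simpa using hne⟩
    have hone : ∀ x ∈ X, ∃ e ∈ E, e ∩ X = {x} := by
      intro x hx
      by_contra! hcon
      have hlt : X.erase x < X := erase_ssubset hx
      refine hX.not_prop_of_lt hlt fun e he ↦ ?_
      obtain ⟨y, hy⟩ := hX.prop e he
      by_contra hempty
      refine hcon e he (eq_singleton_iff_unique_mem.2 ?_)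
      have key : ∀ z ∈ e ∩ X, z = x := by
        intro z hz
        by_contra hzx
        rw [mem_inter] at hz
        exact hempty ⟨z, by simp [hz, hzx]⟩
      exact ⟨key y hy ▸ hy, key⟩
    set E' := ({e ∈ E | 2 ≤ #(e ∩ X)}).image (· ∩ X) with hE'
    refine (ih E' ?_ ?_).elim fun φ hφ ↦ ?_
    · simp only [hE', mem_image, mem_filter]
      rintro _ ⟨e, ⟨he, -⟩, rfl⟩
      exact hX.prop e he
    · intro x
      by_cases hx : x ∈ X
      · obtain ⟨e, he, hex⟩ := hone x hx
        have hsub : {f ∈ E' | x ∈ f} ⊆ (({f ∈ E | x ∈ f}).erase e).image (· ∩ X) := by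
          intro f hf
          simp only [hE', mem_filter, mem_image] at hf
          obtain ⟨⟨f', ⟨hf', hcard⟩, rfl⟩, hxf⟩ := hf
          refine mem_image.2 ⟨f', mem_erase.2 ⟨?_, mem_filter.2 ⟨hf', (mem_inter.1 hxf).1⟩⟩, rfl⟩
          rintro rfl
          simp [hex] at hcard
        have hxe : x ∈ e := (mem_inter.1 (hex ▸ mem_singleton_self x : x ∈ e ∩ X)).1
        have hmem : e ∈ ({f ∈ E | x ∈ f}) := mem_filter.2 ⟨he, hxe⟩
        have := (card_le_card hsub).trans card_image_le
        rw [card_erase_of_mem hmem] at this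
        have := hdeg x
        omega
      · have : ({f ∈ E' | x ∈ f}) = ∅ := by
          simp only [hE', filter_eq_empty_iff, mem_image, mem_filter]
          rintro _ ⟨f, -, rfl⟩ hxf
          exact hx (mem_inter.1 hxf).2
        simp [this]
    · refine ⟨fun x ↦ if x ∈ X then (φ x).succ else 0, fun e he ↦ ?_⟩
      obtain h1 | h2 : #(e ∩ X) = 1 ∨ 2 ≤ #(e ∩ X) := by
        have := (hX.prop e he).card_pos
        omega
      · obtain ⟨x, hx⟩ := card_eq_one.1 h1
        have hxe : x ∈ e ∩ X := by simp [hx]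
        rw [mem_inter] at hxe
        refine ⟨x, hxe.1, fun y hy hyx ↦ ?_⟩
        have hyX : y ∉ X := fun h ↦ hyx (by simpa [hx] using mem_inter.2 ⟨hy, h⟩)
        simpa [hyX, hxe.2] using (Fin.succ_ne_zero _).symm
      · obtain ⟨x, hx, hxu⟩ := hφ (e ∩ X) (mem_image.2 ⟨e, by simp [he, h2], rfl⟩)
        rw [mem_inter] at hx
        refine ⟨x, hx.1, fun y hy hyx ↦ ?_⟩
        by_cases hyX : y ∈ X
        · simpa [hyX, hx.2] using hxu y (mem_inter.2 ⟨hy, hyX⟩) hyx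
        · simpa [hyX, hx.2] using (Fin.succ_ne_zero _).symm

lemma maxCfChromaticNumber_le_succ {r Δ : ℕ} (hr : 0 < r) :
    Hypergraph.maxCfChromaticNumber r Δ ≤ (Δ : ℕ∞) + 1 := by
  have := maxCfChromaticNumber_le (r := r) (Δ := Δ) (k := Δ + 1) fun α _ _ E hE hdeg ↦
    exists_coloring_succ Δ E (fun e he ↦ card_pos.1 (by rw [hE e he]; exact hr)) hdeg
  exact_mod_cast this

/-! ### Lower bounds -/

lemma succ_le_maxCfChromaticNumber_two (Δ : ℕ) :
    (Δ : ℕ∞) + 1 ≤ Hypergraph.maxCfChromaticNumber 2 Δ := by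
  let H : Hypergraph (Fin (Δ + 1)) :=
    { vertexSet := Set.univ
      edgeSet := {e | ∃ x y, x ≠ y ∧ e = {x, y}}
      subset_vertexSet_of_mem_edgeSet' := fun _ _ ↦ Set.subset_univ _ }
  refine succ_le_maxCfChromaticNumber H Set.finite_univ ?_ ?_ ?_
  · rintro _ ⟨x, y, hxy, rfl⟩
    simpa using Set.encard_pair hxy
  · have hdeg : ∀ x, H.degree x = Δ := by
      intro x
      have himage : {e : Set (Fin (Δ + 1)) | e ∈ H.edgeSet ∧ x ∈ e} =
          (fun y ↦ ({x, y} : Set (Fin (Δ + 1)))) '' {y | y ≠ x} := by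
        ext e
        constructor
        · rintro ⟨⟨y, z, hyz, rfl⟩, rfl | rfl⟩
          · exact ⟨z, hyz.symm, rfl⟩
          · exact ⟨y, hyz, Set.pair_comm _ _⟩
        · rintro ⟨y, hy, rfl⟩
          exact ⟨⟨x, y, Ne.symm hy, rfl⟩, by simp⟩
      have hinj : Set.InjOn (fun y ↦ ({x, y} : Set (Fin (Δ + 1)))) {y | y ≠ x} := by
        intro y hy z hz h
        have : y ∈ ({x, z} : Set (Fin (Δ + 1))) := by
          rw [← show ({x, y} : Set (Fin (Δ + 1))) = {x, z} from h]; simp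
        exact this.resolve_left hy
      have hcard : ({y | y ≠ x} : Set (Fin (Δ + 1))) = ((univ.erase x : Finset _) : Set _) := by
        ext y; simp
      rw [Hypergraph.degree, himage, hinj.encard_image, hcard, Set.encard_coe_eq_coe_finsetCard]
      simp
    refine le_antisymm (iSup₂_le fun x _ ↦ (hdeg x).le) ?_
    rw [← hdeg 0]
    exact le_iSup₂ (f := fun x (_ : x ∈ H.vertexSet) ↦ H.degree x) 0 (Set.mem_univ _)
  · rintro ⟨c, hc, hcf⟩
    obtain ⟨x, y, hxy, hcxy⟩ := Fintype.exists_ne_map_eq_of_card_lt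
      (fun x : Fin (Δ + 1) ↦ (⟨c x, hc x (Set.mem_univ _)⟩ : Fin Δ)) (by simp)
    have hcxy : c x = c y := congrArg Fin.val hcxy
    obtain ⟨z, hz, hzu⟩ := hcf {x, y} ⟨x, y, hxy, rfl⟩
    obtain rfl | rfl := hz
    · exact hzu y (by simp) hxy.symm hcxy.symm
    · exact hzu x (by simp) hxy hcxy

/-- Hypergraphs of maximum degree `2`, presented by their duals: `ι` indexes the edges, there are
`m j` vertices of each type `j`, and they lie in the edges of the set `ends j`, of size at most `2`.
A `2`-coloring enters only through the number `R j` of vertices of type `j` that have color `0`; it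
is conflict-free when each edge has exactly one vertex, or all but one, of color `0`. -/
lemma three_le_maxCfChromaticNumber_of_dual {ι J : Type} [Fintype ι] [DecidableEq ι] [Fintype J]
    (ends : J → Finset ι) (m : J → ℕ) (r : ℕ) (hends : ∀ j, #(ends j) ≤ 2)
    (hr : ∀ i, ∑ j with i ∈ ends j, m j = r)
    {j₀ j₁ : J} {i₀ i₁ : ι} (h₀ : ends j₀ = {i₀, i₁}) (hm₀ : 0 < m j₀) (hm₁ : 0 < m j₁)
    (hi₀ : i₀ ∈ ends j₁) (hi₁ : i₁ ∉ ends j₁)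
    (hR : ∀ R : J → ℕ, (∀ j, R j ≤ m j) →
      ¬ ∀ i, ∑ j with i ∈ ends j, R j = 1 ∨ ∑ j with i ∈ ends j, R j + 1 = r) :
    (2 : ℕ∞) + 1 ≤ Hypergraph.maxCfChromaticNumber r 2 := by
  classical
  let edge : ι → Finset (Σ j, Fin (m j)) := fun i ↦ {x | i ∈ ends x.1}
  let H : Hypergraph (Σ j, Fin (m j)) :=
    { vertexSet := Set.univ
      edgeSet := Set.range fun i ↦ (edge i : Set (Σ j, Fin (m j)))
      subset_vertexSet_of_mem_edgeSet' := fun _ _ ↦ Set.subset_univ _ }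
  have hedge : ∀ i, edge i = ({j | i ∈ ends j} : Finset J).sigma fun j ↦ univ := by
    intro i; ext x; simp [edge]
  have hcard : ∀ i, #(edge i) = r := by
    intro i
    rw [hedge, card_sigma, ← hr i]
    simp
  have hdegree : ∀ x, H.degree x = (((ends x.1).image edge).card : ℕ∞) := by
    intro x
    rw [Hypergraph.degree, ← card_image_of_injective _ Finset.coe_injective,
      ← Set.encard_coe_eq_coe_finsetCard]
    congr 1
    ext e
    simp only [H, Set.mem_range, Set.mem_ofPred_eq, coe_image, Set.mem_image]
    constructor
    · rintro ⟨⟨i, rfl⟩, hx⟩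
      exact ⟨_, ⟨i, by simpa [edge] using hx, rfl⟩, rfl⟩
    · rintro ⟨_, ⟨i, hi, rfl⟩, rfl⟩
      exact ⟨⟨i, rfl⟩, by simpa [edge] using hi⟩
  have := succ_le_maxCfChromaticNumber (r := r) (Δ := 2) (k := 2) H Set.finite_univ ?_ ?_ ?_
  · exact_mod_cast this
  · rintro _ ⟨i, rfl⟩
    simp [hcard i]
  · refine le_antisymm (iSup₂_le fun x _ ↦ ?_) ?_
    · rw [hdegree]
      exact_mod_cast card_image_le.trans (hends x.1)
    · refine le_trans ?_ (le_iSup₂ (f := fun x (_ : x ∈ H.vertexSet) ↦ H.degree x)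
        (⟨j₀, ⟨0, hm₀⟩⟩ : Σ j, Fin (m j)) (Set.mem_univ _))
      have hne : edge i₀ ≠ edge i₁ := by
        intro h
        have : (⟨j₁, ⟨0, hm₁⟩⟩ : Σ j, Fin (m j)) ∈ edge i₁ := by rw [← h]; simpa [edge] using hi₀
        exact hi₁ (by simpa [edge] using this)
      rw [hdegree, h₀, image_insert, image_singleton, card_pair hne]
  · rintro ⟨c, hc, hcf⟩
    refine hR (fun j ↦ #{b : Fin (m j) | c ⟨j, b⟩ = 0}) (fun j ↦ ?_) fun i ↦ ?_
    · exact (card_filter_le _ _).trans (by simp)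
    have hzero : ∑ j with i ∈ ends j, #{b : Fin (m j) | c ⟨j, b⟩ = 0} =
        #{x ∈ edge i | c x = 0} := by
      rw [hedge, ← card_sigma]
      congr 1
      ext x; simp
    rw [hzero]
    obtain ⟨x, hx, hxu⟩ := hcf _ ⟨i, rfl⟩
    have hx : x ∈ edge i := hx
    have hc2 : ∀ y, c y = 0 ∨ c y = 1 := fun y ↦ by
      have := hc y (Set.mem_univ _)
      omega
    obtain h | h := hc2 x
    · left
      refine card_eq_one.2 ⟨x, ?_⟩
      ext y
      simp only [mem_filter, mem_singleton]
      refine ⟨fun hy ↦ ?_, fun hy ↦ hy ▸ ⟨hx, h⟩⟩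
      by_contra hyx
      exact hxu y hy.1 hyx (hy.2.trans h.symm)
    · right
      have : ({x ∈ edge i | c x = 0} : Finset _) = (edge i).erase x := by
        ext y
        simp only [mem_filter, mem_erase]
        refine ⟨fun hy ↦ ⟨?_, hy.1⟩, fun hy ↦ ⟨hy.2, ?_⟩⟩
        · rintro rfl
          omega
        · have := hxu y hy.2 hy.1
          have := hc2 y
          omega
      rw [this, card_erase_of_mem hx, hcard]
      have := card_pos.2 ⟨x, hx⟩
      rw [hcard] at this
      omega

/-- For even `r` the dual is the triangle with all multiplicities `r / 2`: its three edges would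
need an odd number of vertices of color `0` each, but the sum of these numbers is even. -/
lemma three_le_maxCfChromaticNumber_of_even {m : ℕ} (hm : 0 < m) :
    (2 : ℕ∞) + 1 ≤ Hypergraph.maxCfChromaticNumber (2 * m) 2 := by
  refine three_le_maxCfChromaticNumber_of_dual (ι := Fin 3) (J := Fin 3)
    ![{0, 1}, {0, 2}, {1, 2}] (fun _ ↦ m) (2 * m) (by decide) ?_
    (j₀ := 0) (j₁ := 1) (i₀ := 0) (i₁ := 1) rfl hm hm (by decide) (by decide) ?_
  · intro i
    have : #{j : Fin 3 | i ∈ (![{0, 1}, {0, 2}, {1, 2}] : Fin 3 → Finset (Fin 3)) j} = 2 := by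
      revert i; decide
    simp [this]
  · intro R _ h
    have h0 := h 0
    have h1 := h 1
    have h2 := h 2
    simp [sum_filter, Fin.sum_univ_succ] at h0 h1 h2
    omega

/-- For odd `r = 2 * q + 1 ≥ 7` the dual has a central edge `0` and two blobs `1, 2, 3` and
`4, 5, 6`, each joined to `0` by three vertices, which it shares with `1` resp. `4`. A parity
argument in a blob shows that these three do not all have the same color, so edge `0` has at least
two vertices of either color. -/
lemma three_le_maxCfChromaticNumber_of_odd {q : ℕ} (hq : 3 ≤ q) :
    (2 : ℕ∞) + 1 ≤ Hypergraph.maxCfChromaticNumber (2 * q + 1) 2 := by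
  refine three_le_maxCfChromaticNumber_of_dual (ι := Fin 7) (J := Fin 9)
    ![{0, 1}, {0, 4}, {0}, {1, 2}, {1, 3}, {2, 3}, {4, 5}, {4, 6}, {5, 6}]
    ![3, 3, 2 * q - 5, q - 1, q - 1, q + 2, q - 1, q - 1, q + 2] (2 * q + 1) (by decide) ?_
    (j₀ := 0) (j₁ := 1) (i₀ := 0) (i₁ := 1) rfl (by simp) (by simp) (by decide) (by decide) ?_
  · intro i
    fin_cases i <;> simp [sum_filter, Fin.sum_univ_succ] <;> omega
  · intro R hR h
    have blob : ∀ a x y z : ℕ, a ≤ 3 → x ≤ q - 1 → y ≤ q - 1 → z ≤ q + 2 →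
        (a + x + y = 1 ∨ a + x + y = 2 * q) → (x + z = 1 ∨ x + z = 2 * q) →
        (y + z = 1 ∨ y + z = 2 * q) → 1 ≤ a ∧ a ≤ 2 := by
      intros; omega
    have b0 := hR 0
    have b1 := hR 1
    have b2 := hR 2
    have b3 := hR 3
    have b4 := hR 4
    have b5 := hR 5
    have b6 := hR 6
    have b7 := hR 7
    have b8 := hR 8
    have h0 := h 0
    have h1 := h 1
    have h2 := h 2
    have h3 := h 3
    have h4 := h 4
    have h5 := h 5
    have h6 := h 6
    simp at b0 b1 b2 b3 b4 b5 b6 b7 b8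
    simp [sum_filter, Fin.sum_univ_succ, ← add_assoc] at h0 h1 h2 h3 h4 h5 h6
    have := blob _ _ _ _ b0 b3 b4 b5 h1 h2 h3
    have := blob _ _ _ _ b1 b6 b7 b8 h4 h5 h6
    omega

/-! ### Four-uniform hypergraphs -/

section FourUniform

variable {α κ : Type*}

lemma hasUniqueColor_congr {φ ψ : α → κ} {e : Finset α} (h : ∀ x ∈ e, φ x = ψ x) :
    HasUniqueColor φ e ↔ HasUniqueColor ψ e := by
  unfold HasUniqueColor
  grind

/-- Two edges share a vertex outside `g`. -/
def AdjOff (E : Finset (Finset α)) (g a b : Finset α) : Prop :=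
  a ∈ E ∧ b ∈ E ∧ ∃ w ∈ a, w ∈ b ∧ w ∉ g

lemma AdjOff.symm {E : Finset (Finset α)} {g a b : Finset α} (h : AdjOff E g a b) :
    AdjOff E g b a := by
  obtain ⟨ha, hb, w, hwa, hwb, hw⟩ := h
  exact ⟨hb, ha, w, hwb, hwa, hw⟩

variable [DecidableEq α]

lemma exists_eq_insert_of_card_eq_four {e : Finset α} (he : #e = 4) {u : α} (hu : u ∈ e) :
    ∃ x y z, x ≠ u ∧ y ≠ u ∧ z ≠ u ∧ x ≠ y ∧ x ≠ z ∧ y ≠ z ∧ e = {u, x, y, z} := by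
  obtain ⟨x, y, z, hxy, hxz, hyz, h⟩ := card_eq_three.1
    (show #(e.erase u) = 3 by rw [card_erase_of_mem hu, he])
  have hmem : ∀ w ∈ ({x, y, z} : Finset α), w ≠ u := fun w hw ↦ by
    rw [← h] at hw
    exact ne_of_mem_erase hw
  exact ⟨x, y, z, hmem x (by simp), hmem y (by simp), hmem z (by simp), hxy, hxz, hyz,
    by rw [← h, insert_erase hu]⟩

/-- No color is unique on a set of four vertices iff it splits into two monochromatic pairs. -/
lemma not_hasUniqueColor_iff {φ : α → κ} {u x y z : α} (hxu : x ≠ u) (hyu : y ≠ u) (hzu : z ≠ u)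
    (hxy : x ≠ y) (hxz : x ≠ z) (hyz : y ≠ z) :
    ¬ HasUniqueColor φ {u, x, y, z} ↔
      (φ u = φ x ∧ φ y = φ z) ∨ (φ u = φ y ∧ φ x = φ z) ∨ (φ u = φ z ∧ φ x = φ y) := by
  simp only [HasUniqueColor, mem_insert, mem_singleton, exists_eq_or_imp, exists_eq_left,
    forall_eq_or_imp, forall_eq]
  grind

lemma eq_of_not_hasUniqueColor_update {φ : α → κ} {e : Finset α} (he : #e = 4) {u : α} (hu : u ∈ e)
    {a b : κ} (ha : ¬ HasUniqueColor (Function.update φ u a) e)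
    (hb : ¬ HasUniqueColor (Function.update φ u b) e) : a = b := by
  obtain ⟨x, y, z, hxu, hyu, hzu, hxy, hxz, hyz, rfl⟩ := exists_eq_insert_of_card_eq_four he hu
  rw [not_hasUniqueColor_iff hxu hyu hzu hxy hxz hyz] at ha hb
  simp only [Function.update_self, Function.update_of_ne hxu, Function.update_of_ne hyu,
    Function.update_of_ne hzu] at ha hb
  grind

/-- The edge `g` is the only one on which no color is unique. -/
structure OnlyBad (E : Finset (Finset α)) (φ : α → κ) (g : Finset α) : Prop where
  mem : g ∈ E
  bad : ¬ HasUniqueColor φ g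
  good : ∀ h ∈ E, h ≠ g → HasUniqueColor φ h

variable [Fintype κ] [DecidableEq κ] {E : Finset (Finset α)}

/-- Recoloring a vertex `u` of the only bad edge repairs that edge, so another edge at `u` must turn
bad. By counting, the other colors at `u` correspond bijectively to the other edges at `u`. -/
lemma OnlyBad.exists_update (hE : ∀ e ∈ E, #e = 4)
    (hdeg : ∀ x, #{e ∈ E | x ∈ e} ≤ Fintype.card κ)
    (hbad : ¬ ∃ φ : α → κ, ∀ e ∈ E, HasUniqueColor φ e) {φ : α → κ} {g : Finset α}
    (hg : OnlyBad E φ g) {u : α} (hu : u ∈ g) :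
    (∀ k ≠ φ u, ∃ h ∈ E, h ≠ g ∧ u ∈ h ∧ OnlyBad E (Function.update φ u k) h) ∧
      ∀ h ∈ E, h ≠ g → u ∈ h → ∃ k ≠ φ u, OnlyBad E (Function.update φ u k) h := by
  have hself : Function.update φ u (φ u) = φ := Function.update_eq_self u φ
  have hmain : ∀ k ≠ φ u, ∃ h ∈ E, ¬ HasUniqueColor (Function.update φ u k) h := fun k _ ↦ by
    by_contra! hcon
    exact hbad ⟨_, hcon⟩
  have hprop : ∀ k ≠ φ u, ∀ h ∈ E, ¬ HasUniqueColor (Function.update φ u k) h →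
      h ≠ g ∧ u ∈ h := by
    intro k hk h hh hkh
    have hne : h ≠ g := by
      rintro rfl
      exact hk (eq_of_not_hasUniqueColor_update (hE h hh) hu hkh (by rw [hself]; exact hg.bad))
    refine ⟨hne, ?_⟩
    by_contra huh
    refine hkh ((hasUniqueColor_congr fun x hx ↦ ?_).1 (hg.good h hh hne))
    rw [Function.update_of_ne]
    rintro rfl
    exact huh hx
  choose! F hFE hFbad using hmain
  have hsurj : Set.SurjOn F (univ.erase (φ u)) (({e ∈ E | u ∈ e}).erase g) := by
    refine surjOn_of_injOn_of_card_le F (fun k hk ↦ ?_) (fun k hk l hl hkl ↦ ?_) ?_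
    · have hk : k ≠ φ u := by simpa using hk
      have := hprop k hk _ (hFE k hk) (hFbad k hk)
      simp [this.1, this.2, hFE k hk]
    · have hk : k ≠ φ u := by simpa using hk
      have hl : l ≠ φ u := by simpa using hl
      exact eq_of_not_hasUniqueColor_update (hE _ (hFE k hk))
        (hprop k hk _ (hFE k hk) (hFbad k hk)).2 (hFbad k hk) (hkl ▸ hFbad l hl)
    · rw [card_erase_of_mem (mem_univ _), card_erase_of_mem (by simp [hg.mem, hu])]
      exact Nat.sub_le_sub_right (hdeg u) 1
  have honly : ∀ k ≠ φ u, OnlyBad E (Function.update φ u k) (F k) := by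
    refine fun k hk ↦ ⟨hFE k hk, hFbad k hk, fun h hh hne ↦ ?_⟩
    by_contra hkh
    obtain ⟨hhg, huh⟩ := hprop k hk h hh hkh
    obtain ⟨l, hl, rfl⟩ := hsurj (show h ∈ _ by simp [hh, hhg, huh])
    have hl : l ≠ φ u := by simpa using hl
    exact hne (by rw [eq_of_not_hasUniqueColor_update (hE _ hh) huh hkh (hFbad l hl)])
  refine ⟨fun k hk ↦ ?_, fun h hh hhg huh ↦ ?_⟩
  · obtain ⟨h1, h2⟩ := hprop k hk _ (hFE k hk) (hFbad k hk)
    exact ⟨F k, hFE k hk, h1, h2, honly k hk⟩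
  · obtain ⟨k, hk, rfl⟩ := hsurj (show h ∈ _ by simp [hh, hhg, huh])
    have hk : k ≠ φ u := by simpa using hk
    exact ⟨k, hk, honly k hk⟩

/-- The bad edge can be moved along a walk without recoloring the vertices of `g`. -/
lemma OnlyBad.steer (hE : ∀ e ∈ E, #e = 4)
    (hdeg : ∀ x, #{e ∈ E | x ∈ e} ≤ Fintype.card κ)
    (hbad : ¬ ∃ φ : α → κ, ∀ e ∈ E, HasUniqueColor φ e) {φ : α → κ} {f g : Finset α}
    (hf : OnlyBad E φ f) {f' : Finset α} (hff' : Relation.ReflTransGen (AdjOff E g) f f') :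
    ∃ ψ : α → κ, OnlyBad E ψ f' ∧ ∀ x ∈ g, ψ x = φ x := by
  induction hff' with
  | refl => exact ⟨φ, hf, fun _ _ ↦ rfl⟩
  | @tail a b _ hab ih =>
    obtain ⟨ψ, hψ, heq⟩ := ih
    obtain ⟨-, hb, w, hwa, hwb, hwg⟩ := hab
    by_cases hba : b = a
    · exact ⟨ψ, hba ▸ hψ, heq⟩
    obtain ⟨k, -, hk⟩ := (hψ.exists_update hE hdeg hbad hwa).2 b hb hba hwb
    refine ⟨_, hk, fun x hx ↦ ?_⟩
    rw [Function.update_of_ne (by rintro rfl; exact hwg hx), heq x hx]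

/-- If the edges at `u ∈ g` other than `g` are connected outside `g` to edges at all other vertices
of `g`, then `g` cannot be the only bad edge. Otherwise it can be turned into two pairs of colors
`i ≠ j`, with `u` of color `i`. Recoloring `u` by a third color makes another edge bad, and the bad
edge can be moved to a vertex `y ∈ g` of color `j`. But the other vertices of `g` now have three
different colors, so recoloring `y` cannot make `g` the bad edge again. -/
lemma not_onlyBad_of_connected (hE : ∀ e ∈ E, #e = 4) (hκ : 3 ≤ Fintype.card κ)
    (hdeg : ∀ x, #{e ∈ E | x ∈ e} ≤ Fintype.card κ)
    (hbad : ¬ ∃ φ : α → κ, ∀ e ∈ E, HasUniqueColor φ e) {g : Finset α} {u : α} (hu : u ∈ g)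
    (hconn : ∀ h ∈ E, h ≠ g → u ∈ h → ∀ s ∈ g, s ≠ u →
      ∃ f ∈ E, f ≠ g ∧ s ∈ f ∧ Relation.ReflTransGen (AdjOff E g) h f)
    {φ : α → κ} (hφ : OnlyBad E φ g) : False := by
  have hg := hφ.mem
  -- The bad edge leaves `g` at `u`, which gets color `k`, and returns at `s`.
  have round : ∀ ψ : α → κ, OnlyBad E ψ g → ∀ k ≠ ψ u, ∀ s ∈ g, s ≠ u →
      ∃ χ : α → κ, OnlyBad E χ g ∧ χ u = k ∧ ∀ x ∈ g, x ≠ u → x ≠ s → χ x = ψ x := by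
    intro ψ hψ k hk s hs hsu
    obtain ⟨h, hh, hhg, huh, hbadh⟩ := (hψ.exists_update hE hdeg hbad hu).1 k hk
    obtain ⟨f, hf, hfg, hsf, hpath⟩ := hconn h hh hhg huh s hs hsu
    obtain ⟨χ, hχ, heq⟩ := hbadh.steer hE hdeg hbad hpath
    obtain ⟨l, -, hl⟩ := (hχ.exists_update hE hdeg hbad hsf).2 g hg hfg.symm hs
    refine ⟨_, hl, ?_, fun x hx hxu hxs ↦ ?_⟩
    · rw [Function.update_of_ne hsu.symm, heq u hu, Function.update_self]
    · rw [Function.update_of_ne hxs, heq x hx, Function.update_of_ne hxu]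
  have third : ∀ i j : κ, ∃ k, k ≠ i ∧ k ≠ j := by
    intro i j
    obtain ⟨k, hk⟩ := exists_mem_notMem_of_card_lt_card
      (show #({i, j} : Finset κ) < #(univ : Finset κ) from card_le_two.trans_lt hκ)
    exact ⟨k, by simpa using hk.2⟩
  obtain ⟨ψ, x, y, z, hxu, hyu, hzu, hxy, hxz, hyz, rfl, hψ, hux, hyz', huy⟩ :
      ∃ (ψ : α → κ) (x y z : α), x ≠ u ∧ y ≠ u ∧ z ≠ u ∧ x ≠ y ∧ x ≠ z ∧ y ≠ z ∧
        g = {u, x, y, z} ∧ OnlyBad E ψ g ∧ ψ u = ψ x ∧ ψ y = ψ z ∧ ψ u ≠ ψ y := by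
    obtain ⟨x, y, z, hxu, hyu, hzu, hxy, hxz, hyz, rfl⟩ :=
      exists_eq_insert_of_card_eq_four (hE g hg) hu
    have hcases := (not_hasUniqueColor_iff hxu hyu hzu hxy hxz hyz).1 hφ.bad
    by_cases hmono : φ u = φ x ∧ φ u = φ y ∧ φ u = φ z
    · obtain ⟨k, hk, -⟩ := third (φ u) (φ u)
      obtain ⟨χ, hχ, hχu, hχeq⟩ := round φ hφ k hk x (by simp) hxu
      have hχy := hχeq y (by simp) hyu hxy.symm
      have hχz := hχeq z (by simp) hzu hxz.symm
      have hχcases := (not_hasUniqueColor_iff hxu hyu hzu hxy hxz hyz).1 hχ.bad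
      refine ⟨χ, x, y, z, hxu, hyu, hzu, hxy, hxz, hyz, rfl, hχ, ?_⟩
      grind
    · obtain h | h | h := hcases
      · exact ⟨φ, x, y, z, hxu, hyu, hzu, hxy, hxz, hyz, rfl, hφ, by grind⟩
      · refine ⟨φ, y, x, z, hyu, hxu, hzu, hxy.symm, hyz, hxz, ?_, hφ, by grind⟩
        ext; simp; tauto
      · refine ⟨φ, z, x, y, hzu, hxu, hyu, hxz.symm, hyz.symm, hxy, ?_, hφ, by grind⟩
        ext; simp; tauto
  obtain ⟨k, hki, hkj⟩ := third (ψ u) (ψ y)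
  obtain ⟨χ, hχ, hχu, hχeq⟩ := round ψ hψ k hki y (by simp) hyu
  have hχx := hχeq x (by simp) hxu hxy
  have hχz := hχeq z (by simp) hzu hyz.symm
  have hχcases := (not_hasUniqueColor_iff hxu hyu hzu hxy hxz hyz).1 hχ.bad
  grind

/-- A nonempty union of components of the hypergraph after the vertices of `e` are deleted. -/
structure IsSeparated (E : Finset (Finset α)) (e K : Finset α) : Prop where
  nonempty : K.Nonempty
  disjoint : Disjoint K e
  covered : ∀ v ∈ K, ∃ f ∈ E, v ∈ f
  subset : ∀ f ∈ E, ∀ v ∈ f, v ∈ K → f ⊆ K ∪ e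

/-- An analogue of Brooks' theorem for `4`-uniform hypergraphs. In a minimal counterexample each
edge can be made the only bad one. Choose an edge `e` and a component `K` of the complement of `e`,
with `K` as small as possible, and an edge `g` that meets both. By the choice of `K` all edges at
the vertices of `g ∩ K` are connected to `e` outside `g`. -/
theorem exists_coloring_of_card_eq_four [Fintype α] (hκ : 3 ≤ Fintype.card κ)
    (E : Finset (Finset α)) (hE : ∀ e ∈ E, #e = 4)
    (hdeg : ∀ x, #{e ∈ E | x ∈ e} ≤ Fintype.card κ) :
    ∃ φ : α → κ, ∀ e ∈ E, HasUniqueColor φ e := by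
  classical
  induction E using Finset.strongInduction with
  | H E ih =>
  have ih' : ∀ F ⊂ E, ∃ φ : α → κ, ∀ e ∈ F, HasUniqueColor φ e := fun F hF ↦
    ih F hF (fun e he ↦ hE e (hF.subset he))
      fun x ↦ (card_le_card (filter_subset_filter _ hF.subset)).trans (hdeg x)
  by_contra hbad
  have hstate : ∀ e ∈ E, ∃ φ : α → κ, OnlyBad E φ e := by
    intro e he
    obtain ⟨φ, hφ⟩ := ih' _ (erase_ssubset he)
    have hgood : ∀ h ∈ E, h ≠ e → HasUniqueColor φ h := fun h hh hne ↦
      hφ h (mem_erase.2 ⟨hne, hh⟩)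
    refine ⟨φ, he, fun hφe ↦ hbad ⟨φ, fun h hh ↦ ?_⟩, hgood⟩
    by_cases hhe : h = e
    · exact hhe ▸ hφe
    · exact hgood h hh hhe
  have hother : ∀ e ∈ E, ∀ u ∈ e, ∃ h ∈ E, h ≠ e ∧ u ∈ h := by
    intro e he u hu
    obtain ⟨φ, hφ⟩ := hstate e he
    have : Nontrivial κ := Fintype.one_lt_card_iff_nontrivial.1 (by omega)
    obtain ⟨k, hk⟩ := exists_ne (φ u)
    obtain ⟨h, hh, hhe, huh, -⟩ := (hφ.exists_update hE hdeg hbad hu).1 k hk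
    exact ⟨h, hh, hhe, huh⟩
  have hdiff : ∀ e ∈ E, ∀ f ∈ E, f ≠ e → (f \ e).Nonempty := by
    intro e he f hf hne
    rw [nonempty_iff_ne_empty, Ne, sdiff_eq_empty_iff_subset]
    exact fun hsub ↦ hne (eq_of_subset_of_card_le hsub (by rw [hE e he, hE f hf]))
  obtain ⟨e₀, he₀⟩ : E.Nonempty := by
    have hκ' : Nonempty κ := Fintype.card_pos_iff.1 (by omega)
    by_contra hempty
    rw [not_nonempty_iff_eq_empty] at hempty
    exact hbad ⟨fun _ ↦ Classical.arbitrary κ, by simp [hempty]⟩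
  have hex : ({p ∈ E ×ˢ (univ : Finset (Finset α)) | IsSeparated E p.1 p.2}).Nonempty := by
    obtain ⟨u, hu⟩ : e₀.Nonempty := card_pos.1 (by rw [hE e₀ he₀]; norm_num)
    obtain ⟨f, hf, hfe, -⟩ := hother e₀ he₀ u hu
    obtain ⟨w, hw⟩ := hdiff e₀ he₀ f hf hfe
    rw [mem_sdiff] at hw
    refine ⟨(e₀, E.biUnion id \ e₀), ?_⟩
    simp only [mem_filter, mem_product, mem_univ, and_true]
    refine ⟨he₀, ⟨w, ?_⟩, sdiff_disjoint, fun v hv ↦ ?_, fun f hf v _ _ x hx ↦ ?_⟩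
    · simpa [hw.2] using ⟨f, hf, hw.1⟩
    · have := (mem_sdiff.1 hv).1
      simpa using this
    · by_cases hxe : x ∈ e₀
      · simp [hxe]
      · simpa [hxe] using ⟨f, hf, hx⟩
  obtain ⟨⟨e, K⟩, hmem, hmin⟩ := exists_min_image _ (fun p ↦ #p.2) hex
  simp only [mem_filter, mem_product, mem_univ, and_true] at hmem hmin
  obtain ⟨he, hK⟩ := hmem
  -- Otherwise the edges meeting `K` and the other ones could be colored separately.
  obtain ⟨g, hg, u, hug, huK, r, hrg, hre⟩ :
      ∃ g ∈ E, ∃ u ∈ g, u ∈ K ∧ ∃ r ∈ g, r ∈ e := by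
    by_contra! hcon
    obtain ⟨v, hv⟩ := hK.nonempty
    obtain ⟨f, hf, hvf⟩ := hK.covered v hv
    have hKe : ∀ x ∈ e, x ∉ K := fun x hx hxK ↦ disjoint_left.1 hK.disjoint hxK hx
    obtain ⟨φ, hφ⟩ := ih' {h ∈ E | ∃ x ∈ h, x ∈ K} (filter_ssubset.2 ⟨e, he, by simpa using hKe⟩)
    obtain ⟨ψ, hψ⟩ := ih' {h ∈ E | ¬ ∃ x ∈ h, x ∈ K}
      (filter_ssubset.2 ⟨f, hf, by simpa using ⟨v, hvf, hv⟩⟩)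
    refine hbad ⟨fun x ↦ if x ∈ K then φ x else ψ x, fun h hh ↦ ?_⟩
    by_cases hhK : ∃ x ∈ h, x ∈ K
    · refine (hasUniqueColor_congr fun y hy ↦ ?_).1 (hφ h (by simpa [hh] using hhK))
      obtain ⟨x, hx, hxK⟩ := hhK
      have hy' := hK.subset h hh x hx hxK hy
      have : y ∈ K := (mem_union.1 hy').resolve_right (hcon h hh x hx hxK y hy)
      simp [this]
    · refine (hasUniqueColor_congr fun y hy ↦ ?_).1 (hψ h (by simpa [hh] using hhK))
      have : y ∉ K := fun hyK ↦ hhK ⟨y, hy, hyK⟩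
      simp [this]
  have hge : g ≠ e := by
    rintro rfl
    exact disjoint_left.1 hK.disjoint huK hug
  -- By minimality of `K`, since `K ∖ g` minus what is connected to `e` is separated by `g`.
  have hreach : ∀ s ∈ g, s ∈ K → ∀ h ∈ E, h ≠ g → s ∈ h →
      Relation.ReflTransGen (AdjOff E g) e h := by
    intro s hsg hsK h hh hhg hsh
    by_contra hnot
    have hstep : ∀ a ∈ E, ∀ b ∈ E, ∀ w ∈ a, w ∈ b → w ∉ g →
        Relation.ReflTransGen (AdjOff E g) e a → Relation.ReflTransGen (AdjOff E g) e b :=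
      fun a ha b hb w hwa hwb hwg hea ↦ hea.tail ⟨ha, hb, w, hwa, hwb, hwg⟩
    let K' : Finset α := {v ∈ K | v ∉ g ∧ ∀ f ∈ E, v ∈ f →
      ¬ Relation.ReflTransGen (AdjOff E g) e f}
    -- An edge not connected to `e` that meets `K` lies in `K` outside `g`, and hence in `K'`.
    have hclosed : ∀ f ∈ E, ¬ Relation.ReflTransGen (AdjOff E g) e f → ∀ v ∈ f, v ∈ K →
        ∀ x ∈ f, x ∉ g → x ∈ K' := by
      intro f hf hnf v hvf hvK x hx hxg
      have hxK : x ∈ K := by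
        refine (mem_union.1 (hK.subset f hf v hvf hvK hx)).resolve_right fun hxe ↦ hnf ?_
        exact hstep e he f hf x hxe hx hxg .refl
      refine mem_filter.2 ⟨hxK, hxg, fun f' hf' hxf' hef' ↦ hnf ?_⟩
      exact hstep f' hf' f hf x hxf' hx hxg hef'
    have hsep : IsSeparated E g K' := by
      obtain ⟨w, hw⟩ := hdiff g hg h hh hhg
      rw [mem_sdiff] at hw
      refine ⟨⟨w, hclosed h hh hnot s hsh hsK w hw.1 hw.2⟩, ?_, ?_, ?_⟩
      · exact disjoint_left.2 fun v hv ↦ (mem_filter.1 hv).2.1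
      · exact fun v hv ↦ hK.covered v (mem_filter.1 hv).1
      · intro f hf v hvf hvK' x hx
        obtain ⟨hvK, -, hv⟩ := mem_filter.1 hvK'
        by_cases hxg : x ∈ g
        · exact mem_union_right _ hxg
        · exact mem_union_left _ (hclosed f hf (hv f hf hvf) v hvf hvK x hx hxg)
    refine (hmin (g, K') ⟨hg, hsep⟩).not_gt (card_lt_card ?_)
    exact filter_ssubset.2 ⟨s, hsK, fun hs ↦ hs.1 hsg⟩
  obtain ⟨φ, hφ⟩ := hstate g hg
  refine not_onlyBad_of_connected hE hκ hdeg hbad hug (fun h hh hhg huh s hs _ ↦ ?_) hφ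
  have : Std.Symm (AdjOff E g) := ⟨fun _ _ ↦ AdjOff.symm⟩
  have hsymm : Relation.ReflTransGen (AdjOff E g) h e :=
    Std.Symm.symm _ _ (hreach u hug huK h hh hhg huh)
  obtain hsK | hse := mem_union.1 (hK.subset g hg u hug huK hs)
  · obtain ⟨f, hf, hfg, hsf⟩ := hother g hg s hs
    exact ⟨f, hf, hfg, hsf, hsymm.trans (hreach s hs hsK f hf hfg hsf)⟩
  · exact ⟨e, he, hge.symm, hse, hsymm⟩

end FourUniform

lemma maxCfChromaticNumber_four_le {Δ : ℕ} (hΔ : 3 ≤ Δ) :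
    Hypergraph.maxCfChromaticNumber 4 Δ ≤ (Δ : ℕ∞) :=
  maxCfChromaticNumber_le fun _ _ _ E hE hdeg ↦
    exists_coloring_of_card_eq_four (by simpa using hΔ) E hE (by simpa using hdeg)

/-! ### A counting form of the Lovász local lemma -/

section LocalLemma

/-- The number of functions on `β` that take no value of `S` exactly once. -/
noncomputable def noUniqueCount (β : Type*) {κ : Type*} (S : Set κ) : ℕ :=
  Nat.card {b : β → κ // ∀ i ∈ S, Nat.card {x // b x = i} ≠ 1}

lemma noUniqueCount_congr {β γ κ : Type*} (S : Set κ) (f : β ≃ γ) :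
    noUniqueCount β S = noUniqueCount γ S := by
  refine Nat.card_congr ((Equiv.arrowCongr f (Equiv.refl κ)).subtypeEquiv fun b ↦ ?_)
  refine forall₂_congr fun i _ ↦ ?_
  rw [Nat.card_congr (f.subtypeEquiv (p := fun x ↦ b x = i)
    (q := fun y ↦ (Equiv.arrowCongr f (Equiv.refl κ)) b y = i) fun x ↦ by simp)]

variable {α κ : Type*} [Fintype α] [DecidableEq α] [Fintype κ]

/-- Independence of a property of the values on `s` and a property of the values off `s`: swap the
values off `s` in a pair of functions. -/
lemma card_filter_and_mul_card {P Q : (α → κ) → Prop} [DecidablePred P] [DecidablePred Q]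
    (s : Finset α)
    (hP : ∀ g h, (∀ x ∈ s, g x = h x) → P g → P h) (hQ : ∀ g h, (∀ x ∉ s, g x = h x) → Q g → Q h) :
    #{g | P g ∧ Q g} * Fintype.card (α → κ) = #{g | P g} * #{g | Q g} := by
  rw [← card_univ, ← card_product, ← card_product]
  have hinv : ∀ p : (α → κ) × (α → κ),
      (s.piecewise (s.piecewise p.1 p.2) (s.piecewise p.2 p.1),
        s.piecewise (s.piecewise p.2 p.1) (s.piecewise p.1 p.2)) = p := by
    rintro ⟨g, h⟩
    ext x <;> by_cases hx : x ∈ s <;> simp [hx]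
  refine card_nbij' (fun p ↦ (s.piecewise p.1 p.2, s.piecewise p.2 p.1))
    (fun p ↦ (s.piecewise p.1 p.2, s.piecewise p.2 p.1)) ?_ ?_
    (fun p _ ↦ hinv p) (fun p _ ↦ hinv p)
  · rintro ⟨g, h⟩ hp
    simp only [coe_product, coe_filter, mem_univ, true_and, Set.mem_prod, Set.mem_ofPred_eq,
      coe_univ, Set.mem_univ, and_true] at hp ⊢
    exact ⟨hP g _ (fun x hx ↦ by simp [hx]) hp.1, hQ g _ (fun x hx ↦ by simp [hx]) hp.2⟩
  · rintro ⟨g, h⟩ hp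
    simp only [coe_product, coe_filter, mem_univ, true_and, Set.mem_prod, Set.mem_ofPred_eq,
      coe_univ, Set.mem_univ, and_true] at hp ⊢
    exact ⟨hP g _ (fun x hx ↦ by simp [hx]) hp.1, hQ h _ (fun x hx ↦ by simp [hx]) hp.2⟩

/-- The inductive form of the local lemma: conditioning on the edges in `F` not being bad raises the
probability that `e` is bad from `1 / (4 * D)` at most to `1 / (2 * D)`. -/
lemma two_mul_card_bad_le {B : Finset α → (α → κ) → Prop} [∀ e, DecidablePred (B e)] [DecidableEq κ]
    [Nonempty κ]
    (hB : ∀ e g h, (∀ x ∈ e, g x = h x) → B e g → B e h) {E : Finset (Finset α)} {D : ℕ}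
    (hD : 0 < D) (hnbr : ∀ e ∈ E, #{f ∈ E | ¬ Disjoint f e} ≤ D)
    (hcount : ∀ e ∈ E, 4 * D * #{g | B e g} ≤ Fintype.card (α → κ)) (F : Finset (Finset α)) :
    F ⊆ E → ∀ e ∈ E, 2 * D * #{g | B e g ∧ ∀ f ∈ F, ¬ B f g} ≤ #{g | ∀ f ∈ F, ¬ B f g} := by
  induction F using Finset.strongInduction with
  | H F ih =>
  intro hF e he
  set R := {f ∈ F | Disjoint f e} with hR
  set bad := #{g | B e g ∧ ∀ f ∈ R, ¬ B f g} with hbad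
  set good := #{g | ∀ f ∈ R, ¬ B f g} with hgood
  have h1 : #{g | B e g ∧ ∀ f ∈ F, ¬ B f g} ≤ bad :=
    card_le_card fun g hg ↦ by
      simp only [mem_filter, mem_univ, true_and] at hg ⊢
      exact ⟨hg.1, fun f hf ↦ hg.2 f (mem_filter.1 hf).1⟩
  have h2 : 4 * D * bad ≤ good := by
    have hind : bad * Fintype.card (α → κ) = #{g | B e g} * good := by
      refine card_filter_and_mul_card e (hB e) fun g h hgh hg f hf hBf ↦ hg f hf ?_
      refine hB f h g (fun x hx ↦ (hgh x ?_).symm) hBf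
      exact disjoint_left.1 (mem_filter.1 hf).2 hx
    refine Nat.le_of_mul_le_mul_right ?_ ((Fintype.card_pos : 0 < Fintype.card (α → κ)))
    calc 4 * D * bad * Fintype.card (α → κ) = 4 * D * #{g | B e g} * good := by
          rw [mul_assoc, hind, ← mul_assoc]
      _ ≤ Fintype.card (α → κ) * good := Nat.mul_le_mul_right _ (hcount e he)
      _ = good * Fintype.card (α → κ) := mul_comm _ _
  have h3 : good ≤ #{g | ∀ f ∈ F, ¬ B f g} +
      ∑ f ∈ {f ∈ F | ¬ Disjoint f e}, #{g | B f g ∧ ∀ f ∈ R, ¬ B f g} := by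
    refine le_trans (card_le_card ?_) ((card_union_le _ _).trans
      (Nat.add_le_add_left card_biUnion_le _))
    intro g hg
    simp only [mem_filter, mem_univ, true_and, mem_union, mem_biUnion] at hg ⊢
    by_contra! hcon
    obtain ⟨f, hf, hBf⟩ := hcon.1
    by_cases hfe : Disjoint f e
    · exact hg f (mem_filter.2 ⟨hf, hfe⟩) hBf
    · obtain ⟨f', hf', hBf'⟩ := hcon.2 f ⟨hf, hfe⟩ hBf
      exact hg f' hf' hBf'
  have h4 : 2 * D * ∑ f ∈ {f ∈ F | ¬ Disjoint f e}, #{g | B f g ∧ ∀ f ∈ R, ¬ B f g} ≤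
      D * good := by
    rw [mul_sum]
    refine (sum_le_card_nsmul _ _ good fun f hf ↦ ?_).trans ?_
    · rw [mem_filter] at hf
      exact ih R (filter_ssubset.2 ⟨f, hf.1, hf.2⟩) ((filter_subset _ _).trans hF) f (hF hf.1)
    · rw [smul_eq_mul]
      exact Nat.mul_le_mul_right _
        ((card_le_card (filter_subset_filter _ hF)).trans (hnbr e he))
  have h5 : 2 * ∑ f ∈ {f ∈ F | ¬ Disjoint f e}, #{g | B f g ∧ ∀ f ∈ R, ¬ B f g} ≤ good :=
    Nat.le_of_mul_le_mul_left (by linarith) hD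
  have h6 := Nat.mul_le_mul_left (2 * D) h1
  linarith

/-- The symmetric local lemma for events `B e` that depend on the values on `e` only, each meeting
at most `D` events and having probability at most `1 / (4 * D)`. -/
lemma exists_forall_not_bad {B : Finset α → (α → κ) → Prop} [Nonempty κ]
    (hB : ∀ e g h, (∀ x ∈ e, g x = h x) → B e g → B e h) {E : Finset (Finset α)} {D : ℕ}
    (hD : 0 < D) (hnbr : ∀ e ∈ E, #{f ∈ E | ¬ Disjoint f e} ≤ D)
    (hcount : ∀ e ∈ E, 4 * D * Nat.card {g // B e g} ≤ Fintype.card (α → κ)) :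
    ∃ g : α → κ, ∀ e ∈ E, ¬ B e g := by
  classical
  simp only [Nat.card_eq_fintype_card, Fintype.card_subtype] at hcount
  have hpos : ∀ F ⊆ E, 0 < #{g | ∀ f ∈ F, ¬ B f g} := by
    intro F
    induction F using Finset.induction_on with
    | empty => exact fun _ ↦ card_pos.2 ⟨fun _ ↦ Classical.arbitrary κ, by simp⟩
    | insert e F _ ih =>
      intro hF
      have hFE := (subset_insert e F).trans hF
      have h1 := ih hFE
      have h2 := two_mul_card_bad_le hB hD hnbr hcount F hFE e (hF (mem_insert_self e F))
      have h3 : #{g | ∀ f ∈ F, ¬ B f g} ≤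
          #{g | ∀ f ∈ insert e F, ¬ B f g} + #{g | B e g ∧ ∀ f ∈ F, ¬ B f g} := by
        refine (card_le_card fun g hg ↦ ?_).trans (card_union_le _ _)
        simp only [mem_filter, mem_univ, true_and, mem_union, forall_mem_insert] at hg ⊢
        tauto
      have h4 : 2 * #{g | B e g ∧ ∀ f ∈ F, ¬ B f g} ≤
          2 * D * #{g | B e g ∧ ∀ f ∈ F, ¬ B f g} :=
        Nat.mul_le_mul_right _ (by omega)
      omega
  obtain ⟨g, hg⟩ := card_pos.1 (hpos E subset_rfl)
  exact ⟨g, (mem_filter.1 hg).2⟩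

/-- A uniformly random function takes some value of `S` exactly once on each edge with positive
probability, if the expected number of exceptions is small enough for the local lemma. -/
lemma exists_forall_unique [Nonempty κ] (S : Set κ) {r Δ : ℕ} (hr : 0 < r) (hΔ : 0 < Δ)
    (hcount : 4 * (r * Δ) * noUniqueCount (Fin r) S ≤ Fintype.card κ ^ r)
    (E : Finset (Finset α)) (hE : ∀ e ∈ E, #e = r) (hdeg : ∀ x, #{e ∈ E | x ∈ e} ≤ Δ) :
    ∃ g : α → κ, ∀ e ∈ E, ∃ i ∈ S, ∃ x ∈ e, g x = i ∧ ∀ y ∈ e, y ≠ x → g y ≠ i := by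
  classical
  obtain ⟨g, hg⟩ := exists_forall_not_bad (κ := κ) (E := E) (D := r * Δ)
    (B := fun e g ↦ ∀ i ∈ S, Nat.card {x : {x // x ∈ e} // g x = i} ≠ 1)
    (fun e g h hgh hg i hi ↦ by
      have : ∀ x : {x // x ∈ e}, g x = h x := fun x ↦ hgh x x.2
      simpa only [this] using hg i hi)
    (Nat.mul_pos hr hΔ)
    (fun e he ↦ by
      refine (card_le_card (t := e.biUnion fun x ↦ {f ∈ E | x ∈ f}) fun f hf ↦ ?_).trans
        (card_biUnion_le.trans ((sum_le_card_nsmul _ _ Δ fun x _ ↦ hdeg x).trans ?_))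
      · simp only [mem_filter, not_disjoint_iff, mem_biUnion] at hf ⊢
        obtain ⟨hf, x, hxf, hxe⟩ := hf
        exact ⟨x, hxe, hf, hxf⟩
      · simp [hE e he])
    (fun e he ↦ by
      have hcard : Fintype.card {x // x ∈ e} = r := by simp [hE e he]
      have hsum : r + Fintype.card {x // x ∉ e} = Fintype.card α := by
        rw [← hcard]
        rw [Fintype.card_subtype_compl, Nat.add_sub_of_le (Fintype.card_subtype_le _)]
      let φ := Equiv.piEquivPiSubtypeProd (fun x ↦ x ∈ e) fun _ : α ↦ κ
      have hbad : Nat.card {g : α → κ // ∀ i ∈ S, Nat.card {x : {x // x ∈ e} // g x = i} ≠ 1} =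
          noUniqueCount (Fin r) S * Fintype.card κ ^ Fintype.card {x // x ∉ e} := by
        rw [← noUniqueCount_congr S (Fintype.equivFinOfCardEq hcard), noUniqueCount]
        have h1 := Nat.card_congr (φ.subtypeEquiv
          (p := fun g ↦ ∀ i ∈ S, Nat.card {x : {x // x ∈ e} // g x = i} ≠ 1)
          (q := fun p ↦ ∀ i ∈ S, Nat.card {x : {x // x ∈ e} // p.1 x = i} ≠ 1) fun g ↦ Iff.rfl)
        rw [h1, Nat.card_congr (Equiv.prodSubtypeFstEquivSubtypeProd (β := {x // x ∉ e} → κ)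
          (p := fun b : {x // x ∈ e} → κ ↦ ∀ i ∈ S, Nat.card {x // b x = i} ≠ 1)),
          Nat.card_prod, Nat.card_eq_fintype_card (α := {x // x ∉ e} → κ), Fintype.card_fun]
      rw [hbad, ← mul_assoc, Fintype.card_fun, ← hsum, pow_add]
      exact Nat.mul_le_mul_right _ hcount)
  refine ⟨g, fun e he ↦ ?_⟩
  have := hg e he
  push Not at this
  obtain ⟨i, hi, hcard⟩ := this
  obtain ⟨h1, ⟨⟨⟨x, hx⟩, hxi⟩⟩⟩ := Nat.card_eq_one_iff_unique.1 hcard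
  refine ⟨i, hi, x, hx, hxi, fun y hy hyx hyi ↦ hyx ?_⟩
  have := h1.elim ⟨⟨y, hy⟩, hyi⟩ ⟨⟨x, hx⟩, hxi⟩
  simpa using this

end LocalLemma

open Real
open scoped Nat

/-! ### Functions that take no value exactly once -/

/-- Such a function takes at most half as many values as its domain has elements. -/
lemma noUniqueCount_univ_le {r k : ℕ} (hk : r / 2 ≤ k) :
    noUniqueCount (Fin r) (Set.univ : Set (Fin k)) ≤ k.choose (r / 2) * (r / 2) ^ r := by
  simp only [noUniqueCount, Nat.card_eq_fintype_card, Fintype.card_subtype, Set.mem_univ,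
    forall_true_left]
  have hsub : ({b | ∀ i, #{x | b x = i} ≠ 1} : Finset (Fin r → Fin k)) ⊆
      (powersetCard (r / 2) univ).biUnion fun I ↦ Fintype.piFinset fun _ ↦ I := by
    intro b hb
    rw [mem_filter_univ] at hb
    have himage : #(univ.image b) ≤ r / 2 := by
      have h1 : #(univ.image b) * 2 ≤ ∑ i ∈ univ.image b, #{x | b x = i} := by
        rw [← smul_eq_mul]
        refine card_nsmul_le_sum _ _ _ fun i hi ↦ ?_
        obtain ⟨x, -, hx⟩ := mem_image.1 hi
        have : 0 < #{x | b x = i} := card_pos.2 ⟨x, by simpa using hx⟩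
        have := hb i
        omega
      rw [← card_eq_sum_card_image, card_univ, Fintype.card_fin] at h1
      omega
    obtain ⟨I, hI, hcard⟩ := exists_superset_card_eq himage (by simpa using hk)
    refine mem_biUnion.2 ⟨I, by simp [mem_powersetCard, hcard], ?_⟩
    exact Fintype.mem_piFinset.2 fun x ↦ hI (mem_image_of_mem b (mem_univ x))
  refine (card_le_card hsub).trans (card_biUnion_le.trans (le_of_eq ?_))
  rw [sum_congr rfl (g := fun _ ↦ (r / 2) ^ r) fun I hI ↦ by
    simp [Fintype.card_piFinset, (mem_powersetCard.1 hI).2]]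
  simp [card_powersetCard]

/-- The exponential series without its linear term, at `1`. -/
lemma sum_inv_factorial_le (n : ℕ) :
    ∑ j ∈ range (n + 1) with j ≠ 1, (1 / j ! : ℝ) ≤ exp 1 - 1 := by
  have h1 : ∑ j ∈ range (n + 1) with j ≠ 1, (1 / j ! : ℝ) ≤
      ∑ j ∈ (range (n + 2)).erase 1, (1 / j ! : ℝ) := by
    refine sum_le_sum_of_subset_of_nonneg (fun j hj ↦ ?_) fun _ _ _ ↦ by positivity
    simp only [mem_filter, mem_range, mem_erase] at hj ⊢
    exact ⟨hj.2, by omega⟩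
  have h2 := add_sum_erase (range (n + 2)) (fun j ↦ (1 / j ! : ℝ)) (a := 1) (by simp)
  have h3 := sum_le_exp_of_nonneg (zero_le_one' ℝ) (n + 2)
  simp only [one_pow] at h3
  simp only [Nat.factorial_one, Nat.cast_one, div_one] at h2
  linarith

/-- The functions from `n` points to `M + m` values that take none of the last `m` values exactly
once have the exponential generating function `(exp x - x) ^ m * exp (M * x)`, and the lemma bounds
its `n`-th coefficient by its value at `x = 1`. The induction sums over the fibers of the last
value. -/
lemma noUniqueCount_Ici_le (M m : ℕ) : ∀ n : ℕ,
    (noUniqueCount (Fin n) {i : Fin (M + m) | M ≤ i.val} : ℝ) ≤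
      n ! * ((exp 1 - 1) ^ m * exp 1 ^ M) := by
  classical
  induction m with
  | zero =>
    intro n
    have h1 : (noUniqueCount (Fin n) {i : Fin (M + 0) | M ≤ i.val} : ℝ) ≤ (M : ℝ) ^ n := by
      have := Nat.card_le_card_of_injective
        (Subtype.val : {b : Fin n → Fin (M + 0) // ∀ i ∈ {i : Fin (M + 0) | M ≤ i.val},
          Nat.card {x // b x = i} ≠ 1} → _) Subtype.val_injective
      rw [Nat.card_eq_fintype_card (α := Fin n → Fin (M + 0))] at this
      simp only [Fintype.card_fun, Fintype.card_fin] at this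
      exact_mod_cast this
    have h2 : (M : ℝ) ^ n / n ! ≤ exp M := pow_div_factorial_le_exp _ (by positivity) n
    rw [div_le_iff₀ (by positivity)] at h2
    rw [← exp_one_rpow, rpow_natCast] at h2
    rw [pow_zero, one_mul, mul_comm]
    exact h1.trans h2
  | succ m ih =>
    intro n
    set C : ℝ := (exp 1 - 1) ^ m * exp 1 ^ M with hC
    have hC0 : 0 ≤ C := by
      have := add_one_le_exp (1 : ℝ)
      have : 0 ≤ exp 1 - 1 := by linarith
      positivity
    have hfiber : ∀ T : Finset (Fin n),
        (#{b : Fin n → Fin (M + m + 1) | (∀ i : Fin (M + m + 1), M ≤ i.val → #{x | b x = i} ≠ 1) ∧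
          ({x | b x = Fin.last _} : Finset (Fin n)) = T} : ℝ) ≤
            if #T ≠ 1 then (n - #T)! * C else 0 := by
      intro T
      split_ifs with hT
      · have hcard : Fintype.card {x // x ∉ T} = n - #T := by simp
        refine le_trans ?_ (ih (n - #T))
        rw [← noUniqueCount_congr _ (Fintype.equivFinOfCardEq hcard)]
        simp only [noUniqueCount, Nat.card_eq_fintype_card, Fintype.card_subtype,
          Set.mem_ofPred_eq]
        refine mod_cast card_le_card_of_surjOn
          (fun (b : {x // x ∉ T} → Fin (M + m)) x ↦
            if hx : x ∈ T then Fin.last (M + m) else (b ⟨x, hx⟩).castSucc) fun b hb ↦ ?_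
        simp only [coe_filter, mem_univ, true_and, Set.mem_ofPred_eq] at hb
        have hne : ∀ x : {x // x ∉ T}, b x ≠ Fin.last _ := fun x hx ↦
          x.2 (hb.2 ▸ (by simpa using hx))
        refine ⟨fun x ↦ (b x).castPred (hne x), ?_, ?_⟩
        · simp only [coe_filter, mem_univ, true_and, Set.mem_ofPred_eq]
          intro i hi
          have := hb.1 i.castSucc (by simpa using hi)
          have heq : #{x : {x // x ∉ T} | (b x).castPred (hne x) = i} =
              #{x | b x = i.castSucc} := by
            refine card_bij (fun x _ ↦ x.1) (fun x hx ↦ ?_) (fun x _ y _ h ↦ Subtype.ext h)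
              fun x hx ↦ ?_
            · rw [mem_filter_univ] at hx ⊢
              rw [← hx, Fin.castSucc_castPred]
            · rw [mem_filter_univ] at hx
              have hxT : x ∉ T := by
                rw [← hb.2, mem_filter_univ, hx]
                exact (Fin.castSucc_lt_last i).ne
              exact ⟨⟨x, hxT⟩, by simp [hx], rfl⟩
          rwa [heq]
        · funext x
          by_cases hx : x ∈ T
          · have : b x = Fin.last _ := by
              rw [← hb.2] at hx
              simpa using hx
            simp [hx, this]
          · simp [hx]
      · rw [Nat.cast_nonpos, card_eq_zero, filter_eq_empty_iff]
        rintro b - ⟨hb, rfl⟩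
        exact hT (hb (Fin.last _) (by simp))
    calc (noUniqueCount (Fin n) {i : Fin (M + (m + 1)) | M ≤ i.val} : ℝ)
        = ∑ T : Finset (Fin n), (#{b : Fin n → Fin (M + m + 1) |
            (∀ i : Fin (M + m + 1), M ≤ i.val → #{x | b x = i} ≠ 1) ∧
              ({x | b x = Fin.last _} : Finset (Fin n)) = T} : ℝ) := by
          simp only [noUniqueCount, Nat.card_eq_fintype_card, Fintype.card_subtype,
            Set.mem_ofPred_eq]
          rw [card_eq_sum_card_fiberwise (t := univ)
            (f := fun b : Fin n → Fin (M + m + 1) ↦ ({x | b x = Fin.last _} : Finset (Fin n)))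
            fun _ _ ↦ mem_coe.2 (mem_univ _)]
          simp only [filter_filter, Nat.cast_sum]
          rfl
      _ ≤ ∑ T : Finset (Fin n), if #T ≠ 1 then ((n - #T)! * C : ℝ) else 0 :=
          sum_le_sum fun T _ ↦ hfiber T
      _ = ∑ j ∈ range (n + 1), n.choose j • if j ≠ 1 then ((n - j)! * C : ℝ) else 0 := by
          have := sum_powerset_apply_card (fun j ↦ if j ≠ 1 then ((n - j)! * C : ℝ) else 0)
            (x := (univ : Finset (Fin n)))
          rw [powerset_univ, card_univ, Fintype.card_fin] at this
          exact this
      _ = n ! * C * ∑ j ∈ range (n + 1) with j ≠ 1, (1 / j ! : ℝ) := by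
          rw [sum_filter, mul_sum]
          refine sum_congr rfl fun j hj ↦ ?_
          split_ifs
          · rw [mem_range, Nat.lt_succ_iff] at hj
            rw [nsmul_eq_mul, Nat.cast_choose ℝ hj]
            field_simp
          · simp
      _ ≤ n ! * C * (exp 1 - 1) :=
          mul_le_mul_of_nonneg_left (sum_inv_factorial_le n) (by positivity)
      _ = n ! * ((exp 1 - 1) ^ (m + 1) * exp 1 ^ M) := by rw [hC]; ring

/-! ### Random colorings -/

/-- Uniformly random colors. -/
lemma maxCfChromaticNumber_le_of_choose {r Δ k : ℕ} (hr : 0 < r) (hΔ : 0 < Δ) (hk : 0 < k)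
    (hrk : r / 2 ≤ k)
    (hcount : 4 * (r * Δ) * (k.choose (r / 2) * (r / 2) ^ r) ≤ k ^ r) :
    Hypergraph.maxCfChromaticNumber r Δ ≤ k := by
  have : Nonempty (Fin k) := ⟨⟨0, hk⟩⟩
  refine maxCfChromaticNumber_le fun α _ _ E hE hdeg ↦ ?_
  obtain ⟨g, hg⟩ := exists_forall_unique (κ := Fin k) Set.univ hr hΔ
    (by
      rw [Fintype.card_fin]
      exact (Nat.mul_le_mul_left _ (noUniqueCount_univ_le hrk)).trans hcount) E hE hdeg
  refine ⟨g, fun e he ↦ ?_⟩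
  obtain ⟨i, -, x, hx, rfl, hu⟩ := hg e he
  exact ⟨x, hx, hu⟩

/-- Each of `m` colors has probability `1 / r` at each vertex, and one more color is used for the
rest. -/
lemma maxCfChromaticNumber_le_of_sparse {r Δ m : ℕ} (hr : 0 < r) (hΔ : 0 < Δ) (hm : m ≤ r)
    (hcount : 4 * (r * Δ) * (r ! * ((exp 1 - 1) ^ m * exp 1 ^ (r - m))) ≤ (r : ℝ) ^ r) :
    Hypergraph.maxCfChromaticNumber r Δ ≤ (m + 1 : ℕ) := by
  obtain ⟨M, rfl⟩ := Nat.exists_eq_add_of_le' hm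
  rw [Nat.add_sub_cancel] at hcount
  have : Nonempty (Fin (M + m)) := ⟨⟨0, hr⟩⟩
  refine maxCfChromaticNumber_le fun α _ _ E hE hdeg ↦ ?_
  obtain ⟨g, hg⟩ := exists_forall_unique (κ := Fin (M + m)) {i | M ≤ i.val} hr hΔ
    (by
      rw [Fintype.card_fin]
      have h1 := mul_le_mul_of_nonneg_left (noUniqueCount_Ici_le M m (M + m))
        (show (0 : ℝ) ≤ 4 * ((M + m : ℕ) * Δ) by positivity)
      exact_mod_cast h1.trans hcount) E hE hdeg
  refine ⟨fun x ↦ if h : M ≤ (g x).val then ⟨g x - M, by omega⟩ else Fin.last m, fun e he ↦ ?_⟩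
  obtain ⟨i, hi, x, hx, rfl, hu⟩ := hg e he
  have hi : M ≤ (g x).val := hi
  refine ⟨x, hx, fun y hy hyx h ↦ hu y hy hyx (Fin.ext ?_)⟩
  simp only [hi, dite_true] at h
  have h := congrArg Fin.val h
  split_ifs at h
  · simp only at h
    omega
  · simp only [Fin.val_last] at h
    omega

/-- With `k` colors an edge is bad with probability of order `k ^ (-⌈r / 2⌉)` at most, which is
compared with `1 / Δ`. -/
lemma exists_maxCfChromaticNumber_le_rpow {r : ℕ} (hr : 0 < r) : ∃ c : ℝ, ∀ Δ : ℕ, 0 < Δ →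
    ∃ m : ℕ, Hypergraph.maxCfChromaticNumber r Δ = (m : ℕ∞) ∧
      (m : ℝ) ≤ c * (Δ : ℝ) ^ ((2 : ℝ) / (r : ℝ)) := by
  refine ⟨4 * (r : ℝ) ^ (r + 1) + 1, fun Δ hΔ ↦ ?_⟩
  obtain ⟨s, hs⟩ : ∃ s, s = r / 2 := ⟨_, rfl⟩
  obtain ⟨t, ht⟩ : ∃ t, r = s + t := ⟨r - r / 2, by omega⟩
  have ht0 : 0 < t := by omega
  have hr1 : (1 : ℝ) ≤ r := by exact_mod_cast hr
  have hΔ1 : (1 : ℝ) ≤ Δ := by exact_mod_cast hΔ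
  set A : ℝ := 4 * (r : ℝ) ^ (r + 1) with hA
  have hA1 : 1 ≤ A := by
    have := one_le_pow₀ hr1 (n := r + 1)
    linarith
  set k := ⌈(A * Δ) ^ ((1 : ℝ) / t)⌉₊ with hk
  have hkt : 4 * r ^ (r + 1) * Δ ≤ k ^ t := by
    have h1 : (A * Δ) ^ ((1 : ℝ) / t) ≤ k := Nat.le_ceil _
    have h2 := pow_le_pow_left₀ (by positivity) h1 t
    rw [← rpow_natCast, ← rpow_mul (by positivity), one_div_mul_cancel (by positivity),
      rpow_one, hA] at h2
    exact_mod_cast h2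
  have hrk : r ≤ k := by
    refine (Nat.pow_le_pow_iff_left ht0.ne').1 (le_trans ?_ hkt)
    calc r ^ t ≤ r ^ (r + 1) := Nat.pow_le_pow_right hr (by omega)
      _ ≤ 4 * r ^ (r + 1) * Δ := by nlinarith [Nat.pow_pos (n := r + 1) hr]
  have hle : Hypergraph.maxCfChromaticNumber r Δ ≤ k := by
    refine maxCfChromaticNumber_le_of_choose hr hΔ (by omega) (by omega) ?_
    rw [← hs]
    calc 4 * (r * Δ) * (k.choose s * s ^ r) ≤ 4 * (r * Δ) * (k ^ s * r ^ r) := by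
          gcongr
          · exact Nat.choose_le_pow k s
          · omega
      _ = 4 * r ^ (r + 1) * Δ * k ^ s := by ring
      _ ≤ k ^ t * k ^ s := Nat.mul_le_mul_right _ hkt
      _ = k ^ r := by rw [ht]; ring
  obtain ⟨m, hm⟩ := ENat.ne_top_iff_exists.1 (ne_top_of_le_ne_top (ENat.natCast_ne_top k) hle)
  refine ⟨m, hm.symm, ?_⟩
  have hmk : (m : ℝ) ≤ k := by
    rw [← hm] at hle
    exact_mod_cast hle
  have hexp : (1 : ℝ) / t ≤ 2 / r := by
    rw [div_le_div_iff₀ (by positivity) (by positivity)]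
    have : r ≤ 2 * t := by omega
    have : (r : ℝ) ≤ 2 * t := by exact_mod_cast this
    linarith
  have h1 : (1 : ℝ) ≤ (Δ : ℝ) ^ ((2 : ℝ) / r) := one_le_rpow hΔ1 (by positivity)
  calc (m : ℝ) ≤ k := hmk
    _ ≤ (A * Δ) ^ ((1 : ℝ) / t) + 1 := (Nat.ceil_lt_add_one (by positivity)).le
    _ = A ^ ((1 : ℝ) / t) * (Δ : ℝ) ^ ((1 : ℝ) / t) + 1 := by
        rw [mul_rpow (by positivity) (by positivity)]
    _ ≤ A ^ (1 : ℝ) * (Δ : ℝ) ^ ((2 : ℝ) / r) + (Δ : ℝ) ^ ((2 : ℝ) / r) := by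
        have ht1 : (1 : ℝ) / t ≤ 1 := by
          rw [div_le_one (by positivity)]
          exact_mod_cast ht0
        gcongr
    _ = (A + 1) * (Δ : ℝ) ^ ((2 : ℝ) / r) := by rw [rpow_one]; ring

lemma pow_self_le_three_pow_mul_factorial (s : ℕ) : s ^ s ≤ 3 ^ s * s ! := by
  have h1 : (s : ℝ) ^ s / s ! ≤ exp s := pow_div_factorial_le_exp _ (by positivity) s
  have h2 : exp s ≤ 3 ^ s := by
    rw [← exp_one_rpow, rpow_natCast]
    exact pow_le_pow_left₀ (exp_pos 1).le (exp_one_lt_d9.le.trans (by norm_num)) s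
  rw [div_le_iff₀ (by positivity)] at h1
  have := h1.trans (mul_le_mul_of_nonneg_right h2 (by positivity))
  exact_mod_cast this

lemma maxCfChromaticNumber_le_of_eight_mul_le {r Δ : ℕ} (hr : 16 ≤ r) (hΔ : 8 * r ≤ Δ) :
    Hypergraph.maxCfChromaticNumber r Δ ≤ Δ := by
  refine maxCfChromaticNumber_le_of_choose (by omega) (by omega) (by omega) (by omega) ?_
  obtain ⟨s, hs⟩ : ∃ s, s = r / 2 := ⟨_, rfl⟩
  obtain ⟨u, hu⟩ : ∃ u, r = s + (u + 2) := ⟨r - s - 2, by omega⟩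
  rw [← hs]
  have hexp : ∀ n : ℕ, 36 * (n + 8) ^ 2 ≤ 4 ^ (n + 6) := by
    intro n
    induction n with
    | zero => norm_num
    | succ n ih =>
      rw [show n + 1 + 6 = (n + 6) + 1 by ring, pow_succ 4]
      calc 36 * (n + 1 + 8) ^ 2 ≤ 36 * (2 * (n + 8)) ^ 2 := by gcongr; omega
        _ = 36 * (n + 8) ^ 2 * 4 := by ring
        _ ≤ 4 ^ (n + 6) * 4 := Nat.mul_le_mul_right 4 ih
  have h4 : 36 * s ^ 2 ≤ 4 ^ u := by
    obtain ⟨n, rfl⟩ : ∃ n, s = n + 8 := ⟨s - 8, by omega⟩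
    exact (hexp n).trans (Nat.pow_le_pow_right (by norm_num) (by omega))
  have hchoose : Δ.choose s * s ^ s ≤ Δ ^ s * 3 ^ s := by
    calc Δ.choose s * s ^ s ≤ Δ.choose s * (3 ^ s * s !) :=
          Nat.mul_le_mul_left _ (pow_self_le_three_pow_mul_factorial s)
      _ = s ! * Δ.choose s * 3 ^ s := by ring
      _ ≤ Δ ^ s * 3 ^ s := by
          rw [← Nat.descFactorial_eq_factorial_mul_choose]
          exact Nat.mul_le_mul_right _ (Nat.descFactorial_le_pow Δ s)
  calc 4 * (r * Δ) * (Δ.choose s * s ^ r)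
      = 4 * (r * Δ) * (Δ.choose s * s ^ s) * s ^ (u + 2) := by rw [hu]; ring
    _ ≤ 4 * (Δ * Δ) * (Δ ^ s * 3 ^ (u + 2)) * s ^ (u + 2) := by
        have h3 : Δ ^ s * 3 ^ s ≤ Δ ^ s * 3 ^ (u + 2) :=
          Nat.mul_le_mul_left _ (Nat.pow_le_pow_right (by norm_num) (by omega))
        have hrΔ : r ≤ Δ := by omega
        have := hchoose.trans h3
        gcongr
    _ = Δ ^ (s + 2) * (3 * s) ^ u * (36 * s ^ 2) := by ring
    _ ≤ Δ ^ (s + 2) * (3 * s) ^ u * 4 ^ u := Nat.mul_le_mul_left _ h4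
    _ = Δ ^ (s + 2) * (12 * s) ^ u := by rw [mul_assoc, ← mul_pow]; ring
    _ ≤ Δ ^ (s + 2) * Δ ^ u := Nat.mul_le_mul_left _ (Nat.pow_le_pow_left (by omega) u)
    _ = Δ ^ r := by rw [hu]; ring

lemma factorial_mul_exp_one_pow_le {n : ℕ} (hn : 0 < n) :
    (n ! : ℝ) * exp 1 ^ n ≤ exp 1 * n * (n : ℝ) ^ n := by
  obtain ⟨n, rfl⟩ := Nat.exists_eq_succ_of_ne_zero hn.ne'
  have h := Stirling.stirlingSeq'_antitone (Nat.zero_le n)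
  simp only [Function.comp_apply, Nat.succ_eq_add_one, zero_add, Stirling.stirlingSeq_one] at h
  rw [Stirling.stirlingSeq, div_le_iff₀ (by positivity), sqrt_mul (by norm_num), div_pow] at h
  have h1 : √((n + 1 : ℕ) : ℝ) ≤ (n + 1 : ℕ) := by
    rw [sqrt_le_left (by positivity)]
    have : (1 : ℝ) ≤ (n + 1 : ℕ) := by exact_mod_cast hn
    nlinarith
  calc ((n + 1)! : ℝ) * exp 1 ^ (n + 1)
      ≤ exp 1 / √2 * (√2 * √((n + 1 : ℕ) : ℝ) * (((n + 1 : ℕ) : ℝ) ^ (n + 1) / exp 1 ^ (n + 1))) *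
          exp 1 ^ (n + 1) := by gcongr
    _ = exp 1 * √((n + 1 : ℕ) : ℝ) * ((n + 1 : ℕ) : ℝ) ^ (n + 1) := by field_simp
    _ ≤ _ := by gcongr

lemma maxCfChromaticNumber_le_of_log_le {r Δ : ℕ} (hr : 16 ≤ r) (hΔr : Δ ≤ 8 * r)
    (hlog : 192 * log r ≤ Δ) : Hypergraph.maxCfChromaticNumber r Δ ≤ Δ := by
  have hr0 : (0 : ℝ) < r := by
    have : 0 < r := by omega
    exact_mod_cast this
  have hr16 : (16 : ℝ) ≤ r := by exact_mod_cast hr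
  have hlog1 : 1 ≤ log r := by
    rw [le_log_iff_exp_le hr0]
    exact (exp_one_lt_d9.le.trans (by norm_num)).trans hr16
  have hΔ192 : (192 : ℝ) ≤ Δ := by linarith
  have hΔ192' : 192 ≤ Δ := by exact_mod_cast hΔ192
  set m := Δ / 8 with hm
  have hmr : m ≤ r := by omega
  refine (maxCfChromaticNumber_le_of_sparse (m := m) (by omega) (by omega) hmr ?_).trans
    (by exact_mod_cast (show m + 1 ≤ Δ by omega))
  have hmlog : 8 * log r - 1 ≤ m / 3 := by
    have : Δ ≤ 8 * m + 7 := by omega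
    have : (Δ : ℝ) ≤ 8 * m + 7 := by exact_mod_cast this
    linarith
  -- The failure probability `1 - 1 / e` of a single color.
  have hq : (exp 1 - 1) / exp 1 ≤ exp (-(1 / 3)) := by
    have h3 : 1 / 3 ≤ (exp 1)⁻¹ := by
      rw [one_div]
      exact inv_anti₀ (exp_pos 1) (exp_one_lt_d9.le.trans (by norm_num))
    have h := add_one_le_exp (-(1 / 3) : ℝ)
    rw [sub_div, div_self (exp_pos 1).ne', one_div]
    linarith
  have hq0 : 0 ≤ (exp 1 - 1) / exp 1 := by
    have := add_one_le_exp (1 : ℝ)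
    exact div_nonneg (by linarith) (exp_pos 1).le
  have hqm : ((exp 1 - 1) / exp 1) ^ m * (r : ℝ) ^ 8 ≤ exp 1 := by
    calc ((exp 1 - 1) / exp 1) ^ m * (r : ℝ) ^ 8 ≤ exp (-(1 / 3)) ^ m * (r : ℝ) ^ 8 := by gcongr
      _ = exp (-(m / 3) + 8 * log r) := by
          have hpow : (r : ℝ) ^ 8 = exp (8 * log r) := by
            rw [show 8 * log (r : ℝ) = (8 : ℕ) * log r by norm_num, exp_nat_mul, exp_log hr0]
          rw [exp_add, ← hpow, ← exp_nat_mul]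
          ring_nf
      _ ≤ exp 1 := exp_le_exp.2 (by linarith)
  have hsplit : (exp 1 - 1) ^ m * exp 1 ^ (r - m) = ((exp 1 - 1) / exp 1) ^ m * exp 1 ^ r := by
    conv_rhs => rw [← Nat.add_sub_of_le hmr, pow_add]
    rw [div_pow]
    field_simp
  have he : exp 1 ≤ 3 := exp_one_lt_d9.le.trans (by norm_num)
  have hΔr' : (Δ : ℝ) ≤ 8 * r := by exact_mod_cast hΔr
  set q := ((exp 1 - 1) / exp 1) ^ m with hqdef
  have hqm0 : 0 ≤ q := by positivity
  have hfinal : 4 * (r * (8 * r)) * (exp 1 * r) * q ≤ 1 := by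
    have h5 : (288 : ℝ) ≤ (r : ℝ) ^ 5 :=
      le_trans (by norm_num) (pow_le_pow_left₀ (by norm_num) hr16 5)
    have h6 : 4 * (r * (8 * r)) * (exp 1 * r) * q * (r : ℝ) ^ 5 ≤ 1 * (r : ℝ) ^ 5 := by
      calc 4 * (r * (8 * r)) * (exp 1 * r) * q * (r : ℝ) ^ 5
          = 32 * exp 1 * (q * (r : ℝ) ^ 8) := by ring
        _ ≤ 32 * 3 * 3 := by
            gcongr
            exact hqm.trans he
        _ ≤ 1 * (r : ℝ) ^ 5 := by linarith
    exact le_of_mul_le_mul_right h6 (by positivity)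
  calc 4 * ((r : ℝ) * Δ) * (r ! * ((exp 1 - 1) ^ m * exp 1 ^ (r - m)))
      = 4 * ((r : ℝ) * Δ) * (r ! * exp 1 ^ r) * q := by rw [hsplit]; ring
    _ ≤ 4 * ((r : ℝ) * (8 * r)) * (exp 1 * r * (r : ℝ) ^ r) * q := by
        have := factorial_mul_exp_one_pow_le (n := r) (by omega)
        gcongr
    _ = 4 * (r * (8 * r)) * (exp 1 * r) * q * (r : ℝ) ^ r := by ring
    _ ≤ 1 * (r : ℝ) ^ r := by gcongr
    _ = (r : ℝ) ^ r := one_mul _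

end ConflictFree

theorem theorem3 :
    (∀ r Δ : ℕ, 0 < r → 0 < Δ → (r = 2 ∨ (Δ = 2 ∧ r ≠ 1 ∧ r ≠ 3 ∧ r ≠ 5)) →
      Hypergraph.maxCfChromaticNumber r Δ = (Δ : ℕ∞) + 1) ∧
    (∀ r : ℕ, 0 < r → ∃ c : ℝ, ∀ Δ : ℕ, 0 < Δ →
      ∃ m : ℕ, Hypergraph.maxCfChromaticNumber r Δ = (m : ℕ∞) ∧
        (m : ℝ) ≤ c * (Δ : ℝ) ^ ((2 : ℝ) / (r : ℝ))) ∧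
    (∃ c c₀ : ℝ, ∀ r Δ : ℕ, 0 < r → 0 < Δ → c ≤ (r : ℝ) → c₀ * Real.log (r : ℝ) ≤ (Δ : ℝ) →
      Hypergraph.maxCfChromaticNumber r Δ ≤ (Δ : ℕ∞)) ∧
    (∀ Δ : ℕ, 3 ≤ Δ → Hypergraph.maxCfChromaticNumber 4 Δ ≤ (Δ : ℕ∞)) := by
  refine ⟨fun r Δ hr _ h ↦ ?_, fun r hr ↦ ConflictFree.exists_maxCfChromaticNumber_le_rpow hr,
    ⟨16, 192, fun r Δ _ _ hr hlog ↦ ?_⟩, fun Δ hΔ ↦ ConflictFree.maxCfChromaticNumber_four_le hΔ⟩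
  · refine le_antisymm (ConflictFree.maxCfChromaticNumber_le_succ hr) ?_
    obtain rfl | ⟨rfl, h1, h3, h5⟩ := h
    · exact ConflictFree.succ_le_maxCfChromaticNumber_two Δ
    · obtain ⟨q, rfl | rfl⟩ := r.even_or_odd'
      · exact ConflictFree.three_le_maxCfChromaticNumber_of_even (by omega)
      · exact ConflictFree.three_le_maxCfChromaticNumber_of_odd (by omega)
  · have hr : 16 ≤ r := by exact_mod_cast hr
    obtain hΔ | hΔ := le_total (8 * r) Δ
    · exact ConflictFree.maxCfChromaticNumber_le_of_eight_mul_le hr hΔ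
    · exact ConflictFree.maxCfChromaticNumber_le_of_log_le hr hΔ hlog
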